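/- Let $\Gamma=\mathrm{PSL}_2(\mathbb Z)=\mathrm{SL}_2(\mathbb Z)/\{\pm I\}$, let $X,Y\in\Gamma$ be the classes of $\begin{pmatrix}0&1\\-1&1\end{pmatrix}$ and $\begin{pmatrix}1&1\\0&1\end{pmatrix}$, and for an integer $n\ge 2$ let $\Gamma(n)$ be the principal congruence subgroup of level $n$, i.e. the normal subgroup of those classes having a representative congruent to $I$ modulo $n$. The Farey map of level $n$ is the regular map $\mathcal M_3(n)=(G,x,y)$ with $G=\Gamma/\Gamma(n)$, $x=X\Gamma(n)$, $y=Y\Gamma(n)$: its vertices are the left cosets of $\langle y\rangle$ in $G$, its edges are the left cosets of $\langle xy\rangle$ in $G$, and a vertex and an edge are incident when these cosets intersect. Its underlying graph is the graph on the vertices in which two distinct vertices are adjacent if and only if they are incident to a common edge. A finite connected regular graph of degree $d$ is called Ramanujan if every eigenvalue $\lambda$ of its adjacency matrix with $|\lambda|\ne d$ satisfies $|\lambda|<2\sqrt{d-1}$; that is, if the second largest modulus of its eigenvalues is less than $2\sqrt{d-1}$. Then, for every integer $n\ge 2$, the underlying graph of the Farey map $\mathcal M_3(n)$ is Ramanujan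 if and only if $n$ is prime or $n\in\{4,6,8,9,10,12,14,15,21,27,33\}$. -/

import Mathlib

open Matrix

/-- An (algebraic, orientable) regular map: a finite group `G` with two generators `x`, `y` such
that `(x * y) ^ 2 = 1`. The elements of `G` are the darts of the map. -/
structure RegularMap (G : Type*) [Group G] [Finite G] where
  x : G
  y : G
  closure_eq_top : Subgroup.closure {x, y} = ⊤
  mul_sq : (x * y) ^ 2 = 1

namespace RegularMap

variable {G : Type*} [Group G] [Finite G]

/-- The vertices of a regular map are the left cosets of `⟨y⟩`. -/
abbrev Vertex (M : RegularMap G) : Type _ := G ⧸ Subgroup.zpowers M.y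

/-- The edges of a regular map are the left cosets of `⟨x * y⟩`. -/
abbrev Edge (M : RegularMap G) : Type _ := G ⧸ Subgroup.zpowers (M.x * M.y)

/-- A vertex and an edge are incident when, as cosets, they have a dart in common. -/
def Incident (M : RegularMap G) (v : M.Vertex) (e : M.Edge) : Prop :=
  ∃ g : G, (g : M.Vertex) = v ∧ (g : M.Edge) = e

/-- The underlying graph of a regular map, as a simple graph: two distinct vertices are adjacent
when they are incident to a common edge. -/
def underlyingGraph (M : RegularMap G) : SimpleGraph M.Vertex where
  Adj u v := u ≠ v ∧ ∃ e : M.Edge, M.Incident u e ∧ M.Incident v e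
  symm := ⟨fun _ _ ⟨h, e, hu, hv⟩ => ⟨h.symm, e, hv, hu⟩⟩
  loopless := ⟨fun _ h => h.1 rfl⟩

noncomputable instance (M : RegularMap G) : Fintype M.Vertex := Fintype.ofFinite _

end RegularMap

open Classical in
/-- A finite graph is Ramanujan when it is connected, regular of some degree `d`, and every
eigenvalue of its adjacency matrix whose modulus is not the largest one, `d`, has modulus less
than `2 * √(d - 1)`. -/
def IsRamanujan {V : Type*} [Fintype V] (G : SimpleGraph V) : Prop :=
  G.Connected ∧ ∃ d : ℕ, G.IsRegularOfDegree d ∧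
    ∀ μ : ℝ, Module.End.HasEigenvalue (Matrix.toLin' (G.adjMatrix ℝ)) μ →
      |μ| ≠ (d : ℝ) → |μ| < 2 * Real.sqrt ((d : ℝ) - 1)

namespace Farey

/-- The modular group `PSL₂(ℤ)`, the quotient of `SL₂(ℤ)` by its centre `{I, -I}`. -/
abbrev ModularGroup : Type := ProjectiveSpecialLinearGroup (Fin 2) ℤ

/-- The quotient homomorphism `SL₂(ℤ) → PSL₂(ℤ)`. -/
def proj : SpecialLinearGroup (Fin 2) ℤ →* ModularGroup :=
  QuotientGroup.mk' (Subgroup.center (SpecialLinearGroup (Fin 2) ℤ))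

theorem proj_surjective : Function.Surjective proj := QuotientGroup.mk'_surjective _

/-- The matrix `(0 1; -1 1)`. -/
def matX : SpecialLinearGroup (Fin 2) ℤ := ⟨!![0, 1; -1, 1], by simp [Matrix.det_fin_two]⟩

/-- The matrix `(1 1; 0 1)`. -/
def matY : SpecialLinearGroup (Fin 2) ℤ := ⟨!![1, 1; 0, 1], by simp [Matrix.det_fin_two]⟩

/-- The principal congruence subgroup of level `n` of `PSL₂(ℤ)`: the classes that have a
representative congruent to the identity matrix modulo `n`. -/
def principalCongruenceSubgroup (n : ℕ) : Subgroup ModularGroup :=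
  (CongruenceSubgroup.Gamma n).map proj

instance (n : ℕ) : (principalCongruenceSubgroup n).Normal :=
  Subgroup.Normal.map (CongruenceSubgroup.Gamma_normal n) proj proj_surjective

/-- The group of darts of the Farey map of level `n`. -/
abbrev DartGroup (n : ℕ) : Type := ModularGroup ⧸ principalCongruenceSubgroup n

/-- The quotient homomorphism from `SL₂(ℤ)` to the group of darts. -/
def toDart (n : ℕ) : SpecialLinearGroup (Fin 2) ℤ →* DartGroup n :=
  (QuotientGroup.mk' (principalCongruenceSubgroup n)).comp proj

theorem toDart_surjective (n : ℕ) : Function.Surjective (toDart n) :=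
  (QuotientGroup.mk'_surjective _).comp proj_surjective

instance (n : ℕ) [NeZero n] : Finite (DartGroup n) := by
  have h : (CongruenceSubgroup.Gamma n).FiniteIndex := inferInstance
  have : (principalCongruenceSubgroup n).FiniteIndex :=
    ⟨fun h0 => h.index_ne_zero (Nat.eq_zero_of_zero_dvd (h0 ▸
      Subgroup.index_map_dvd (CongruenceSubgroup.Gamma n) proj_surjective))⟩
  exact Subgroup.finite_quotient_of_finiteIndex

theorem closure_matX_matY : Subgroup.closure {matX, matY} = ⊤ := by
  rw [eq_top_iff, ← SpecialLinearGroup.SL2Z_generators, Subgroup.closure_le]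
  have hX : matX ∈ Subgroup.closure {matX, matY} := Subgroup.subset_closure (by simp)
  have hY : matY ∈ Subgroup.closure {matX, matY} := Subgroup.subset_closure (by simp)
  have hS : _root_.ModularGroup.S = (matX * matY)⁻¹ := by decide
  have hT : _root_.ModularGroup.T = matY := by decide
  rintro g (rfl | rfl)
  · rw [hS]; exact inv_mem (mul_mem hX hY)
  · rw [hT]; exact hY

theorem proj_mul_sq : proj ((matX * matY) ^ 2) = 1 := by
  have h : (matX * matY) ^ 2 = -1 := by decide
  rw [h]
  refine (QuotientGroup.eq_one_iff _).2 (Subgroup.mem_center_iff.2 fun g => ?_)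
  simp

/-- The Farey map of level `n`: the regular map `(Γ ⧸ Γ(n), X Γ(n), Y Γ(n))`, where
`Γ = PSL₂(ℤ)`, `X` and `Y` are the classes of `(0 1; -1 1)` and `(1 1; 0 1)`, and `Γ(n)` is the
principal congruence subgroup of level `n`. -/
def fareyMap (n : ℕ) [NeZero n] : RegularMap (DartGroup n) where
  x := toDart n matX
  y := toDart n matY
  closure_eq_top := by
    rw [← Set.image_pair, ← MonoidHom.map_closure, closure_matX_matY]
    exact Subgroup.map_top_of_surjective _ (toDart_surjective n)
  mul_sq := by
    rw [← map_mul, ← map_pow, toDart, MonoidHom.comp_apply, proj_mul_sq, map_one]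

end Farey

/-! A vertex is the first column, up to sign, of a matrix of determinant one modulo `n`, and two
vertices are adjacent exactly when their columns have determinant `±1`. The graph is connected and
`n`-regular. Its eigenvectors become even functions `f` on the plane over `ZMod n`, zero off the
vectors that extend to a basis of determinant one, with `detSum f = μ • f`.

Bounding eigenvalues: summing over fibres of reduction modulo `d ∣ n` (`push`) carries `f` to a
function `F` with `(n / d) * detSum F = μ * F`. Take the least `d` for which `F ≠ 0`. If `d = 1`
then `μ = n`. Otherwise all further fibre sums of `F` vanish, and Parseval's identity on the plane
and on the lines through the origin bounds the norm of `detSum F` by `√d` times that of `F`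
(`sum_detSum_sq_le`), so `|μ| ≤ n / √d`. For `d = 2, 3` one has exactly `detSum F = -F`, hence `μ =
-n / d`.

Producing eigenvalues: functions modulo a prime `p ∣ n` pull back to the graph. They give `-n / p`
when `p` is `2` or `3` (`hasEigenvalue_neg_div`), and `n / √p` up to sign when `p ≥ 5`
(`hasEigenvalue_sqrt`).

Comparison with `2 * √(n - 1)` leaves the even `n < 16`, the odd multiples of `3` below `36`, and
the primes; a composite `n` with least prime factor `p ≥ 5` fails because `n ≥ p ^ 2`. -/

namespace Farey

/-! ### Matrices modulo `n` and their columns -/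

/-- Reduction modulo `n` of integral matrices of determinant one. -/
def reduce (n : ℕ) : SpecialLinearGroup (Fin 2) ℤ →* SpecialLinearGroup (Fin 2) (ZMod n) :=
  Matrix.SpecialLinearGroup.map (Int.castRingHom (ZMod n))

theorem reduce_apply (n : ℕ) (a : SpecialLinearGroup (Fin 2) ℤ) (i j : Fin 2) :
    reduce n a i j = (a i j : ZMod n) := rfl

theorem reduce_neg (n : ℕ) (a : SpecialLinearGroup (Fin 2) ℤ) : reduce n (-a) = -reduce n a := by
  ext i j; simp [reduce]

theorem proj_eq_one_iff (a : SpecialLinearGroup (Fin 2) ℤ) : proj a = 1 ↔ a = 1 ∨ a = -1 := by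
  rw [proj, QuotientGroup.mk'_apply, QuotientGroup.eq_one_iff,
    Matrix.SpecialLinearGroup.mem_center_iff]
  constructor
  · rintro ⟨r, hr, h⟩
    rw [Fintype.card_fin] at hr
    rcases sq_eq_one_iff.1 hr with rfl | rfl
    · left; ext i j; simp [← h]
    · right; ext i j; simp [← h]
  · rintro (rfl | rfl)
    · exact ⟨1, by simp, by simp⟩
    · exact ⟨-1, by simp, by simp⟩

theorem toDart_eq_one_iff (n : ℕ) (a : SpecialLinearGroup (Fin 2) ℤ) :
    toDart n a = 1 ↔ reduce n a = 1 ∨ reduce n a = -1 := by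
  rw [toDart, MonoidHom.comp_apply, QuotientGroup.mk'_apply, QuotientGroup.eq_one_iff,
    principalCongruenceSubgroup, Subgroup.mem_map]
  constructor
  · rintro ⟨γ, hγ, h⟩
    have h1 : proj (γ⁻¹ * a) = 1 := by rw [map_mul, map_inv, h, inv_mul_cancel]
    have h2 : reduce n γ = 1 := hγ
    rcases (proj_eq_one_iff _).1 h1 with h3 | h3
    · left; rw [← inv_mul_eq_one.1 h3, h2]
    · right
      have : a = γ * (-1) := by rw [← h3, mul_inv_cancel_left]
      rw [this, map_mul, h2, one_mul, reduce_neg, map_one]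
  · rintro (h | h)
    · exact ⟨a, h, rfl⟩
    · refine ⟨-a, ?_, ?_⟩
      · change reduce n (-a) = 1
        rw [reduce_neg, h, neg_neg]
      · rw [← inv_mul_eq_one, ← map_inv, ← map_mul, proj_eq_one_iff]
        right
        rw [inv_mul_eq_iff_eq_mul, mul_neg_one, neg_neg]

theorem toDart_eq_iff (n : ℕ) (a b : SpecialLinearGroup (Fin 2) ℤ) :
    toDart n a = toDart n b ↔ reduce n b = reduce n a ∨ reduce n b = -reduce n a := by
  rw [← inv_mul_eq_one, ← map_inv, ← map_mul, toDart_eq_one_iff, map_mul, map_inv,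
    inv_mul_eq_iff_eq_mul, inv_mul_eq_iff_eq_mul, mul_one, mul_neg_one]

/-- The determinant of two vectors of the plane. -/
def det₂ {R : Type*} [CommRing R] (v w : R × R) : R := v.1 * w.2 - v.2 * w.1

/-- The first column modulo `n` of an integral matrix. -/
def col (n : ℕ) (g : SpecialLinearGroup (Fin 2) ℤ) : ZMod n × ZMod n := (g 0 0, g 1 0)

/-- The second column modulo `n` of an integral matrix. -/
def col' (n : ℕ) (g : SpecialLinearGroup (Fin 2) ℤ) : ZMod n × ZMod n := (g 0 1, g 1 1)

theorem matX_mul_matY : matX * matY = -_root_.ModularGroup.S := by decide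

theorem det₂_col (n : ℕ) (g : SpecialLinearGroup (Fin 2) ℤ) : det₂ (col n g) (col' n g) = 1 := by
  have h := g.det_coe
  rw [Matrix.det_fin_two] at h
  have := congrArg (Int.cast : ℤ → ZMod n) h
  push_cast at this
  rw [det₂, col, col', ← this]; ring

theorem reduce_eq_iff (n : ℕ) (a b : SpecialLinearGroup (Fin 2) ℤ) :
    reduce n a = reduce n b ↔ col n a = col n b ∧ col' n a = col' n b := by
  simp only [Matrix.SpecialLinearGroup.ext_iff, Fin.forall_fin_two, reduce_apply, col, col',
    Prod.mk.injEq]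
  tauto

theorem col_neg (n : ℕ) (g : SpecialLinearGroup (Fin 2) ℤ) : col n (-g) = -col n g := by
  ext <;> simp [col]

theorem col_mul_T_zpow (n : ℕ) (g : SpecialLinearGroup (Fin 2) ℤ) (k : ℤ) :
    col n (g * _root_.ModularGroup.T ^ k) = col n g := by
  ext <;> simp [col, Matrix.mul_apply, ModularGroup.coe_T_zpow]

theorem col'_mul_T_zpow (n : ℕ) (g : SpecialLinearGroup (Fin 2) ℤ) (k : ℤ) :
    col' n (g * _root_.ModularGroup.T ^ k) = col' n g + (k : ZMod n) • col n g := by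
  ext <;> simp [col, col', Matrix.mul_apply, ModularGroup.coe_T_zpow] <;> ring

theorem col_mul_S (n : ℕ) (g : SpecialLinearGroup (Fin 2) ℤ) :
    col n (g * _root_.ModularGroup.S) = col' n g := by
  ext <;> simp [col, col', Matrix.mul_apply, ModularGroup.coe_S]

theorem eq_add_smul_of_det₂ {R : Type*} [CommRing R] {v w u : R × R} (hw : det₂ v w = 1)
    (hu : det₂ v u = 1) : ∃ t : R, u = w + t • v := by
  -- Cramer's rule: if `u = w + t • v`, pairing with `w` gives `det₂ u w = t * det₂ v w = t`.
  refine ⟨det₂ u w, ?_⟩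
  simp only [det₂] at *
  ext
  · simp
    linear_combination -u.1 * hw + w.1 * hu
  · simp
    linear_combination -u.2 * hw + w.2 * hu

/-- The matrices representing the neighbours of the vertex represented by `g`. -/
def nb (n : ℕ) (g : SpecialLinearGroup (Fin 2) ℤ) (t : ZMod n) : SpecialLinearGroup (Fin 2) ℤ :=
  g * _root_.ModularGroup.T ^ (t.cast : ℤ) * _root_.ModularGroup.S

theorem col_nb (n : ℕ) (g : SpecialLinearGroup (Fin 2) ℤ) (t : ZMod n) :
    col n (nb n g t) = col' n g + t • col n g := by
  rw [nb, col_mul_S, col'_mul_T_zpow, ZMod.intCast_zmod_cast]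

theorem toDart_neg (n : ℕ) (g : SpecialLinearGroup (Fin 2) ℤ) : toDart n (-g) = toDart n g := by
  rw [toDart_eq_iff, reduce_neg, neg_neg]; exact .inr rfl

theorem det₂_add_smul {R : Type*} [CommRing R] (v w : R × R) (t : R) :
    det₂ v (w + t • v) = det₂ v w := by
  simp [det₂]; ring

theorem det₂_neg_right {R : Type*} [CommRing R] (v w : R × R) : det₂ v (-w) = -det₂ v w := by
  simp [det₂]; ring

theorem det₂_self {R : Type*} [CommRing R] (v : R × R) : det₂ v v = 0 := by
  simp [det₂]; ring

theorem det₂_col_nb (n : ℕ) (g : SpecialLinearGroup (Fin 2) ℤ) (t : ZMod n) :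
    det₂ (col n g) (col n (nb n g t)) = 1 := by
  rw [col_nb, det₂_add_smul, det₂_col]

/-! ### Vertices as columns up to sign; adjacency, degree and connectedness -/

variable {n : ℕ} [NeZero n]

/-- The vertex of the Farey map represented by an integral matrix. -/
def vert (n : ℕ) [NeZero n] (g : SpecialLinearGroup (Fin 2) ℤ) : (fareyMap n).Vertex :=
  QuotientGroup.mk (toDart n g)

theorem vert_surjective : Function.Surjective (vert n) :=
  (QuotientGroup.mk_surjective).comp (toDart_surjective n)

/-- Right multiplication by `T ^ k` keeps the first column and adds `k` times it to the second. By
`eq_add_smul_of_det₂` this reaches every matrix of determinant one with that first column; the sign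
comes from passing to `PSL₂`. -/
theorem vert_eq_iff (g h : SpecialLinearGroup (Fin 2) ℤ) :
    vert n g = vert n h ↔ col n h = col n g ∨ col n h = -col n g := by
  rw [vert, vert, QuotientGroup.eq, Subgroup.mem_zpowers_iff]
  have key : ∀ k : ℤ, (fareyMap n).y ^ k = (toDart n g)⁻¹ * toDart n h ↔
      toDart n (g * _root_.ModularGroup.T ^ k) = toDart n h := by
    intro k
    rw [eq_inv_mul_iff_mul_eq, map_mul, map_zpow]; rfl
  simp_rw [key, toDart_eq_iff]
  constructor
  · rintro ⟨k, hk | hk⟩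
    · left
      rw [reduce_eq_iff, col_mul_T_zpow] at hk
      exact hk.1
    · right
      rw [← reduce_neg, reduce_eq_iff, col_neg, col_mul_T_zpow] at hk
      exact hk.1
  · have main : ∀ h, col n h = col n g →
        ∃ k : ℤ, reduce n h = reduce n (g * _root_.ModularGroup.T ^ k) := by
      intro h hh
      obtain ⟨t, ht⟩ := eq_add_smul_of_det₂ (det₂_col n g) (hh ▸ det₂_col n h)
      obtain ⟨k, rfl⟩ := ZMod.intCast_surjective t
      exact ⟨k, by rw [reduce_eq_iff, col_mul_T_zpow, col'_mul_T_zpow]; exact ⟨hh, ht⟩⟩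
    rintro (hh | hh)
    · obtain ⟨k, hk⟩ := main h hh
      exact ⟨k, .inl hk⟩
    · obtain ⟨k, hk⟩ := main (-h) (by rw [col_neg, hh, neg_neg])
      exact ⟨k, .inr (by rw [← hk, reduce_neg, neg_neg])⟩

theorem vert_nb_injective (g : SpecialLinearGroup (Fin 2) ℤ) :
    Function.Injective fun t => vert n (nb n g t) := by
  have key : ∀ s t : ZMod n, col n (nb n g s) = col n (nb n g t) → s = t := by
    intro s t h
    rw [col_nb, col_nb, add_right_inj] at h
    have h2 := congrArg (fun v => -det₂ (col' n g) v) h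
    have h3 := det₂_col n g
    simp only [det₂, Prod.smul_fst, Prod.smul_snd, smul_eq_mul] at h2 h3
    linear_combination h2 + (t - s) * h3
  intro s t h
  rcases (vert_eq_iff _ _).1 h with h | h
  · exact (key _ _ h).symm
  -- Columns opposite in sign would have determinants `1` and `-1` with `col n g`. So `1 = -1` in
  -- `ZMod n`, and the sign makes no difference.
  · have h1 := det₂_col_nb n g t
    rw [h, det₂_neg_right, det₂_col_nb] at h1
    refine (key t s ?_).symm
    rw [h]
    ext <;> simp only [Prod.fst_neg, Prod.snd_neg]
    · linear_combination (col n (nb n g s)).1 * h1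
    · linear_combination (col n (nb n g s)).2 * h1

/-- An edge is a pair of darts `{a, a * S}`, since the image of `S` squares to one. The darts at the
vertex of `g` are the `g * T ^ t`, so multiplying them by `S` lists the neighbours. There are no
loops because `det₂ v v = 0 ≠ 1`. -/
theorem adj_vert_iff (hn : 2 ≤ n) (g : SpecialLinearGroup (Fin 2) ℤ) (w : (fareyMap n).Vertex) :
    (fareyMap n).underlyingGraph.Adj (vert n g) w ↔ ∃ t, vert n (nb n g t) = w := by
  have hedge : ∀ a b : SpecialLinearGroup (Fin 2) ℤ,
      ((toDart n a : DartGroup n) : (fareyMap n).Edge) = (toDart n b : DartGroup n) ↔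
      toDart n b = toDart n a ∨ toDart n b = toDart n (a * _root_.ModularGroup.S) := by
    intro a b
    have hxy : (fareyMap n).x * (fareyMap n).y = toDart n _root_.ModularGroup.S := by
      change toDart n matX * toDart n matY = _
      rw [← map_mul, matX_mul_matY, toDart_neg]
    have hS : toDart n _root_.ModularGroup.S ^ 2 = 1 := hxy ▸ (fareyMap n).mul_sq
    rw [QuotientGroup.eq, Subgroup.mem_zpowers_iff, hxy]
    simp_rw [eq_inv_mul_iff_mul_eq]
    constructor
    · rintro ⟨k, hk⟩
      rcases Int.even_or_odd' k with ⟨m, rfl | rfl⟩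
      · left
        rw [← hk, _root_.zpow_mul]
        norm_cast
        rw [hS, _root_.one_zpow, mul_one]
      · right
        rw [← hk, _root_.zpow_add, _root_.zpow_mul, zpow_one, map_mul]
        norm_cast
        rw [hS, _root_.one_zpow, one_mul]
    · rintro (h | h)
      · exact ⟨0, by rw [h, zpow_zero, mul_one]⟩
      · exact ⟨1, by rw [h, zpow_one, map_mul]⟩
  have : Fact (1 < n) := ⟨hn⟩
  constructor
  · rintro ⟨hne, e, ⟨a, ha, rfl⟩, ⟨b, rfl, hb⟩⟩
    obtain ⟨a, rfl⟩ := toDart_surjective n a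
    obtain ⟨b, rfl⟩ := toDart_surjective n b
    rcases (hedge a b).1 hb.symm with h | h
    · rw [h] at hne; exact absurd ha.symm hne
    · rw [h]
      change ∃ t, _ = vert n (a * _root_.ModularGroup.S)
      simp_rw [vert_eq_iff]
      have hdet := det₂_col n a
      rw [← col_mul_S] at hdet
      rcases (vert_eq_iff _ _).1 ha with h1 | h1
      · rw [← h1] at hdet
        obtain ⟨t, ht⟩ := eq_add_smul_of_det₂ (det₂_col n g) hdet
        exact ⟨t, .inl (by rw [ht, col_nb])⟩
      · have : col n a = -col n g := by rw [h1, neg_neg]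
        rw [this] at hdet
        have hdet' : det₂ (col n g) (-col n (a * _root_.ModularGroup.S)) = 1 := by
          rw [← hdet]; simp [det₂]
        obtain ⟨t, ht⟩ := eq_add_smul_of_det₂ (det₂_col n g) hdet'
        exact ⟨t, .inr (by rw [col_nb, ← ht, neg_neg])⟩
  · rintro ⟨t, rfl⟩
    refine ⟨fun h => ?_, QuotientGroup.mk (toDart n (g * _root_.ModularGroup.T ^ (t.cast : ℤ))),
      ⟨toDart n (g * _root_.ModularGroup.T ^ (t.cast : ℤ)), ?_, rfl⟩, ⟨toDart n (nb n g t), rfl, ?_⟩⟩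
    · have h1 := det₂_col_nb n g t
      rcases (vert_eq_iff _ _).1 h with h | h <;> rw [h] at h1 <;>
        simp [det₂_neg_right, det₂_self] at h1
    · exact (vert_eq_iff _ _).2 (.inl (by rw [col_mul_T_zpow]))
    · exact ((hedge _ _).2 (.inr rfl)).symm

open Classical in
theorem sum_neighborFinset (hn : 2 ≤ n) (g : SpecialLinearGroup (Fin 2) ℤ) {M : Type*}
    [AddCommMonoid M] (F : (fareyMap n).Vertex → M) :
    ∑ u ∈ (fareyMap n).underlyingGraph.neighborFinset (vert n g), F u =
      ∑ t : ZMod n, F (vert n (nb n g t)) := by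
  have : (fareyMap n).underlyingGraph.neighborFinset (vert n g) =
      Finset.univ.map ⟨fun t => vert n (nb n g t), vert_nb_injective g⟩ := by
    ext w
    simp [adj_vert_iff hn]
  rw [this, Finset.sum_map]; rfl

open Classical in
theorem isRegularOfDegree_fareyMap (hn : 2 ≤ n) :
    (fareyMap n).underlyingGraph.IsRegularOfDegree n := by
  intro v
  obtain ⟨g, rfl⟩ := vert_surjective v
  rw [SimpleGraph.degree, Finset.card_eq_sum_ones, sum_neighborFinset hn]
  simp [ZMod.card]

theorem connected_fareyMap (hn : 2 ≤ n) : (fareyMap n).underlyingGraph.Connected := by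
  have key : ∀ g : SpecialLinearGroup (Fin 2) ℤ, ∀ a : SpecialLinearGroup (Fin 2) ℤ,
      (fareyMap n).underlyingGraph.Reachable (vert n a) (vert n (a * g)) := by
    intro g
    have hg : g ∈ Subgroup.closure {_root_.ModularGroup.S, _root_.ModularGroup.T} := by
      rw [_root_.SpecialLinearGroup.SL2Z_generators]; trivial
    induction hg using Subgroup.closure_induction with
    | mem x hx =>
      intro a
      rcases hx with rfl | rfl
      · refine SimpleGraph.Adj.reachable ((adj_vert_iff hn _ _).2 ⟨0, ?_⟩)
        simp [nb]
      · rw [(vert_eq_iff (n := n) (a * _root_.ModularGroup.T) a).2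
          (.inl (by simpa using (col_mul_T_zpow n a 1).symm))]
    | one => intro a; rw [mul_one]
    | mul x y _ _ hx hy => intro a; rw [← mul_assoc]; exact (hx a).trans (hy _)
    | inv x _ hx => intro a; simpa using (hx (a * x⁻¹)).symm
  have : Nonempty (fareyMap n).Vertex := ⟨vert n 1⟩
  refine ⟨fun u v => ?_⟩
  obtain ⟨g, rfl⟩ := vert_surjective u
  obtain ⟨h, rfl⟩ := vert_surjective v
  simpa using key (g⁻¹ * h) g

/-! ### The determinant operator and change of level -/

section Operator

variable {n d : ℕ}

/-- Reduction of vectors from modulus `n` to a divisor `d`. -/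
def redVec (h : d ∣ n) : ZMod n × ZMod n →+ ZMod d × ZMod d :=
  (ZMod.castHom h (ZMod d)).toAddMonoidHom.prodMap (ZMod.castHom h (ZMod d)).toAddMonoidHom

theorem redVec_apply (h : d ∣ n) (v : ZMod n × ZMod n) :
    redVec h v = (ZMod.castHom h (ZMod d) v.1, ZMod.castHom h (ZMod d) v.2) := rfl

theorem det₂_redVec (h : d ∣ n) (v w : ZMod n × ZMod n) :
    det₂ (redVec h v) (redVec h w) = ZMod.castHom h (ZMod d) (det₂ v w) := by
  simp only [det₂, redVec_apply, map_sub, map_mul]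

variable [NeZero n]

/-- The sums of `f` over the fibres of `redVec`. -/
def push (h : d ∣ n) (f : ZMod n × ZMod n → ℝ) (x : ZMod d × ZMod d) : ℝ :=
  ∑ v with redVec h v = x, f v

theorem push_neg_of_even (h : d ∣ n) {f : ZMod n × ZMod n → ℝ} (hf : ∀ v, f (-v) = f v)
    (x : ZMod d × ZMod d) : push h f (-x) = push h f x := by
  rw [push, push, Finset.sum_filter, Finset.sum_filter]
  refine Fintype.sum_equiv (Equiv.neg _) _ _ fun v => ?_
  simp [hf, neg_eq_iff_eq_neg]

theorem push_eq_zero (h : d ∣ n) {f : ZMod n × ZMod n → ℝ}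
    (hf : ∀ v, (∀ w, det₂ v w ≠ 1) → f v = 0) (x : ZMod d × ZMod d)
    (hx : ∀ y, det₂ x y ≠ 1) : push h f x = 0 := by
  refine Finset.sum_eq_zero fun v hv => hf v fun w hw => ?_
  obtain rfl := (Finset.mem_filter.1 hv).2
  exact hx (redVec h w) (by rw [det₂_redVec, hw, map_one])

variable [NeZero d]

/-- The sum of `f` over the vectors `w` with `det₂ v w = 1`. -/
def detSum (f : ZMod n × ZMod n → ℝ) (v : ZMod n × ZMod n) : ℝ :=
  ∑ w with det₂ v w = 1, f w

theorem detSum_eq_sum_add_smul (f : ZMod n × ZMod n → ℝ) {v w : ZMod n × ZMod n}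
    (h : det₂ v w = 1) : detSum f v = ∑ t : ZMod n, f (w + t • v) := by
  symm
  refine Finset.sum_bij (fun t _ => w + t • v) ?_ ?_ ?_ fun _ _ => rfl
  · intro t _
    simp [det₂_add_smul, h]
  · intro s _ t _ hst
    rw [add_right_inj] at hst
    have h2 := congrArg (fun v => -det₂ w v) hst
    simp only [det₂, Prod.smul_fst, Prod.smul_snd, smul_eq_mul] at h2 h
    linear_combination h2 + (t - s) * h
  · intro u hu
    obtain ⟨t, ht⟩ := eq_add_smul_of_det₂ h (Finset.mem_filter.1 hu).2
    exact ⟨t, Finset.mem_univ _, ht.symm⟩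

theorem sum_castHom (h : d ∣ n) (f : ZMod d → ℝ) :
    ∑ t : ZMod n, f (ZMod.castHom h (ZMod d) t) = (n / d : ℝ) * ∑ s, f s := by
  have hcard : ∀ s : ZMod d, ((Finset.univ.filter fun t : ZMod n =>
      ZMod.castHom h (ZMod d) t = s).card) = (Finset.univ.filter fun t : ZMod n =>
      ZMod.castHom h (ZMod d) t = 0).card := fun s =>
    AddMonoidHom.card_fiber_eq_of_mem_range (ZMod.castHom h (ZMod d)).toAddMonoidHom
      (ZMod.castHom_surjective h s) (ZMod.castHom_surjective h 0)
  have hsum : ∀ f : ZMod d → ℝ, ∑ t : ZMod n, f (ZMod.castHom h (ZMod d) t) =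
      ((Finset.univ.filter fun t : ZMod n => ZMod.castHom h (ZMod d) t = 0).card : ℝ) *
        ∑ s, f s := by
    intro f
    rw [← Finset.sum_fiberwise Finset.univ (fun t : ZMod n => ZMod.castHom h (ZMod d) t),
      Finset.mul_sum]
    refine Finset.sum_congr rfl fun s _ => ?_
    rw [Finset.sum_congr rfl (g := fun _ => f s) fun t ht => by rw [(Finset.mem_filter.1 ht).2],
      Finset.sum_const, hcard, nsmul_eq_mul]
  -- Testing on the constant function `1` identifies the common fibre size as `n / d`.
  have h1 := hsum fun _ => 1
  simp only [Finset.sum_const, Finset.card_univ, ZMod.card, nsmul_eq_mul, mul_one] at h1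
  have hd : (d : ℝ) ≠ 0 := NeZero.ne _
  rw [hsum, h1, mul_div_cancel_right₀ _ hd]

/-- Reduction maps the line `w + t • v` onto the corresponding line modulo `d`, covering each point
`n / d` times. -/
theorem detSum_comp_redVec (h : d ∣ n) (f : ZMod d × ZMod d → ℝ) {v w : ZMod n × ZMod n}
    (hvw : det₂ v w = 1) :
    detSum (fun u => f (redVec h u)) v = (n / d : ℝ) * detSum f (redVec h v) := by
  have h1 : det₂ (redVec h v) (redVec h w) = 1 := by rw [det₂_redVec, hvw, map_one]
  rw [detSum_eq_sum_add_smul _ hvw, detSum_eq_sum_add_smul _ h1, ← sum_castHom h]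
  refine Finset.sum_congr rfl fun t _ => congrArg f ?_
  rw [map_add]
  ext <;> simp only [redVec_apply, Prod.fst_add, Prod.snd_add, Prod.smul_fst, Prod.smul_snd,
    smul_eq_mul, map_mul]

theorem sum_mul_push (h : d ∣ n) (f : ZMod n × ZMod n → ℝ) (k : ZMod d × ZMod d → ℝ) :
    ∑ x, k x * push h f x = ∑ v, k (redVec h v) * f v := by
  rw [← Finset.sum_fiberwise Finset.univ (redVec h)]
  refine Finset.sum_congr rfl fun x _ => ?_
  rw [push, Finset.mul_sum]
  exact Finset.sum_congr rfl fun v hv => by rw [(Finset.mem_filter.1 hv).2]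

theorem det₂_neg_swap {R : Type*} [CommRing R] (v w : R × R) : det₂ w (-v) = det₂ v w := by
  simp [det₂]; ring

/-- This is adjoint to `detSum_comp_redVec`: for fixed `w` extending to a basis, the lifts `v` of
`x` with `det₂ v w = 1` number `n / d` if `det₂ x (redVec h w) = 1`, and zero otherwise. The
remaining `w` are removed by the support hypothesis. -/
theorem detSum_push (h : d ∣ n) {f : ZMod n × ZMod n → ℝ}
    (hf : ∀ v, (∀ w, det₂ v w ≠ 1) → f v = 0) (x : ZMod d × ZMod d) :
    (n / d : ℝ) * detSum (push h f) x = push h (detSum f) x := by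
  have h1 : detSum (push h f) x = ∑ v, (if det₂ x (redVec h v) = 1 then 1 else 0) * f v := by
    rw [← sum_mul_push h f fun y => if det₂ x y = 1 then 1 else 0, detSum, Finset.sum_filter]
    simp only [ite_mul, one_mul, zero_mul]
  have h2 : push h (detSum f) x = ∑ w, ∑ v, if redVec h v = x then
      if det₂ v w = 1 then f w else 0 else 0 := by
    rw [push, Finset.sum_filter, Finset.sum_comm]
    simp only [detSum, Finset.sum_filter]
    exact Finset.sum_congr rfl fun v _ => by split_ifs <;> simp
  rw [h1, h2, Finset.mul_sum]
  refine Finset.sum_congr rfl fun w _ => ?_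
  by_cases hw : ∃ u, det₂ w u = 1
  · obtain ⟨u, hu⟩ := hw
    -- The lifts are counted by applying the pullback formula to the indicator of `-x`; the sign
    -- turns `det₂ v w` into `det₂ w (-v)`.
    have h2 := detSum_comp_redVec h (fun y => if y = -x then (1 : ℝ) else 0) hu
    simp only [detSum, Finset.sum_filter] at h2
    rw [← mul_assoc]
    have h3 : ∑ y, (if det₂ (redVec h w) y = 1 then if y = -x then (1 : ℝ) else 0 else 0) =
        if det₂ x (redVec h w) = 1 then 1 else 0 := by
      rw [Finset.sum_eq_single (-x)]
      · simp [det₂_neg_swap]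
      · intro y _ hy; simp [hy]
      · simp
    rw [← h3, ← h2, Finset.sum_mul]
    refine Fintype.sum_equiv (Equiv.neg _) _ _ fun v => ?_
    have h4 : det₂ (-v) w = det₂ w v := by rw [← det₂_neg_swap, neg_neg]
    simp only [Equiv.neg_apply, h4, map_neg, neg_eq_iff_eq_neg]
    split_ifs <;> simp
  · push Not at hw
    rw [hf w hw]; simp

theorem push_push {e : ℕ} [NeZero e] (h : d ∣ n) (h' : e ∣ d) (f : ZMod n × ZMod n → ℝ) :
    push h' (push h f) = push (h'.trans h) f := by
  ext x
  have := sum_mul_push h f fun y => if redVec h' y = x then 1 else 0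
  simp only [ite_mul, one_mul, zero_mul, ← Finset.sum_filter] at this
  rw [push, this, push]
  refine Finset.sum_congr (Finset.filter_congr fun v _ => ?_) fun _ _ => rfl
  simp only [redVec_apply, ← RingHom.comp_apply, ZMod.castHom_comp]

theorem push_self (f : ZMod n × ZMod n → ℝ) : push dvd_rfl f = f := by
  ext x
  have : ∀ v, redVec (dvd_refl n) v = v := fun v => by simp [redVec_apply]
  simp only [push, this, Finset.filter_eq', Finset.mem_univ, if_true, Finset.sum_singleton]

end Operator

/-! ### Fourier analysis on the plane and the norm bound -/

section Fourier

variable {n : ℕ} [NeZero n]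

/-- Parseval's identity for the discrete Fourier transform. -/
theorem sum_norm_sq_sum_stdAddChar (g : ZMod n → ℂ) :
    ∑ t : ZMod n, ‖∑ s, g s * ZMod.stdAddChar (t * s)‖ ^ 2 = n * ∑ s, ‖g s‖ ^ 2 := by
  have h : ∀ s s' : ZMod n, ∑ t : ZMod n, (ZMod.stdAddChar (t * s) : ℂ) *
      (starRingEnd ℂ) (ZMod.stdAddChar (t * s')) = if s = s' then (n : ℂ) else 0 := by
    intro s s'
    have := AddChar.sum_mulShift (s - s') (ZMod.isPrimitive_stdAddChar n)
    simp only [sub_eq_zero, ZMod.card] at this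
    rw [Nat.cast_ite, Nat.cast_zero] at this
    rw [← this]
    refine Finset.sum_congr rfl fun t _ => ?_
    rw [mul_sub, sub_eq_add_neg, AddChar.map_add_eq_mul, AddChar.map_neg_eq_conj]
  have hc : ∀ z : ℂ, ((‖z‖ ^ 2 : ℝ) : ℂ) = z * (starRingEnd ℂ) z := fun z => by
    rw [Complex.mul_conj, Complex.normSq_eq_norm_sq]
  apply Complex.ofReal_injective
  push_cast [hc]
  simp only [map_sum, map_mul, Finset.sum_mul_sum]
  rw [Finset.sum_comm, Finset.mul_sum]
  refine Finset.sum_congr rfl fun s _ => ?_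
  rw [Finset.sum_comm]
  have : ∀ s' : ZMod n, ∑ t : ZMod n, g s * ZMod.stdAddChar (t * s) *
      ((starRingEnd ℂ) (g s') * (starRingEnd ℂ) (ZMod.stdAddChar (t * s'))) =
      g s * (starRingEnd ℂ) (g s') * if s = s' then (n : ℂ) else 0 := by
    intro s'
    rw [← h, Finset.mul_sum]
    exact Finset.sum_congr rfl fun t _ => by ring
  rw [Finset.sum_congr rfl fun s' _ => this s']
  simp [mul_comm]

/-- The symplectic Fourier transform of a function on the plane. -/
noncomputable def fourier (f : ZMod n × ZMod n → ℝ) (u : ZMod n × ZMod n) : ℂ :=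
  ∑ w, (f w : ℂ) * ZMod.stdAddChar (det₂ u w)

theorem sum_norm_sq_fourier (f : ZMod n × ZMod n → ℝ) :
    ∑ u, ‖fourier f u‖ ^ 2 = (n : ℝ) ^ 2 * ∑ w, f w ^ 2 := by
  have h1 : ∀ a b : ZMod n, fourier f (a, b) = ∑ y : ZMod n,
      (∑ x : ZMod n, (f (x, y) : ℂ) * ZMod.stdAddChar (-b * x)) * ZMod.stdAddChar (a * y) := by
    intro a b
    rw [fourier, Fintype.sum_prod_type_right]
    refine Finset.sum_congr rfl fun y _ => ?_
    rw [Finset.sum_mul]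
    refine Finset.sum_congr rfl fun x _ => ?_
    rw [mul_assoc, ← AddChar.map_add_eq_mul, det₂]
    congr 2; ring
  rw [Fintype.sum_prod_type_right]
  simp only [h1, sum_norm_sq_sum_stdAddChar]
  rw [← Finset.mul_sum, Finset.sum_comm, Fintype.sum_prod_type_right, pow_two, mul_assoc]
  congr 1
  rw [Finset.mul_sum]
  refine Finset.sum_congr rfl fun y _ => ?_
  refine (Equiv.sum_comp (Equiv.neg (ZMod n)) fun b => ‖∑ x : ZMod n, (f (x, y) : ℂ) *
    ZMod.stdAddChar (b * x)‖ ^ 2).trans ?_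
  rw [sum_norm_sq_sum_stdAddChar]
  simp

/-- Along the multiples of `v` the transform depends on `f` only through its sums over the level
sets of `det₂ v`, so one-dimensional Parseval applies. -/
theorem sum_norm_sq_fourier_smul (f : ZMod n × ZMod n → ℝ) (v : ZMod n × ZMod n) :
    ∑ t : ZMod n, ‖fourier f (t • v)‖ ^ 2 = n * ∑ s, (∑ w with det₂ v w = s, f w) ^ 2 := by
  have h1 : ∀ t : ZMod n, fourier f (t • v) = ∑ s : ZMod n,
      ((∑ w with det₂ v w = s, f w : ℝ) : ℂ) * ZMod.stdAddChar (t * s) := by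
    intro t
    rw [fourier, ← Finset.sum_fiberwise Finset.univ (det₂ v)]
    refine Finset.sum_congr rfl fun s _ => ?_
    rw [Complex.ofReal_sum, Finset.sum_mul]
    refine Finset.sum_congr rfl fun w hw => ?_
    rw [← (Finset.mem_filter.1 hw).2]
    congr 2
    simp [det₂]; ring
  simp only [h1, sum_norm_sq_sum_stdAddChar, Complex.norm_real, Real.norm_eq_abs, sq_abs]

/-- Write `t = a` with `n = gcd(a, n) * d`. Then `a * det₂ u w` depends only on `w` modulo `d`, so
the transform is a combination of the fibre sums of `f` modulo `d`, which vanish. -/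
theorem fourier_smul_eq_zero {f : ZMod n × ZMod n → ℝ}
    (hf : ∀ d (h : d ∣ n), d ≠ n → ∀ [NeZero d], push h f = 0) {t : ZMod n} (ht : ¬IsUnit t)
    (u : ZMod n × ZMod n) : fourier f (t • u) = 0 := by
  obtain ⟨a, rfl⟩ := ZMod.natCast_zmod_surjective t
  rw [ZMod.isUnit_iff_coprime] at ht
  obtain ⟨d, hd⟩ := Nat.gcd_dvd_right a n
  have hdn : d ∣ n := ⟨_, hd.trans (mul_comm _ _)⟩
  have hn0 : n ≠ 0 := NeZero.ne n
  have : NeZero d := ⟨by rintro rfl; simp at hd; exact hn0 hd⟩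
  have hne : d ≠ n := by
    rintro rfl
    have : a.gcd d = 1 := by
      exact (Nat.eq_of_mul_eq_mul_right (Nat.pos_of_ne_zero hn0) ((one_mul d).trans hd)).symm
    exact ht this
  rw [fourier, ← Finset.sum_fiberwise Finset.univ (redVec hdn)]
  refine Finset.sum_eq_zero fun x _ => ?_
  obtain ⟨x1, hx1⟩ := ZMod.castHom_surjective hdn x.1
  obtain ⟨x2, hx2⟩ := ZMod.castHom_surjective hdn x.2
  have hz := congrArg (Complex.ofReal) (congrFun (hf d hdn hne) x)
  rw [push, Complex.ofReal_sum, Pi.zero_apply, Complex.ofReal_zero] at hz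
  have key : ∀ w, redVec hdn w = x → (a : ZMod n) * det₂ u w = a * det₂ u (x1, x2) := by
    intro w hw
    have h1 : ZMod.castHom hdn (ZMod d) (det₂ u w - det₂ u (x1, x2)) = 0 := by
      rw [map_sub, ← det₂_redVec, ← det₂_redVec, hw, sub_eq_zero]
      congr 1
      rw [redVec_apply, hx1, hx2]
    obtain ⟨k, hk⟩ := ZMod.natCast_zmod_surjective (det₂ u w - det₂ u (x1, x2))
    rw [← hk, map_natCast, ZMod.natCast_eq_zero_iff] at h1
    rw [← sub_eq_zero, ← mul_sub, ← hk, ← Nat.cast_mul, ZMod.natCast_eq_zero_iff]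
    rw [hd]
    exact mul_dvd_mul (Nat.gcd_dvd_left _ _) h1
  rw [Finset.sum_congr rfl (g := fun w => (f w : ℂ) *
    ZMod.stdAddChar ((a : ZMod n) * det₂ u (x1, x2))), ← Finset.sum_mul, hz, zero_mul]
  intro w hw
  rw [← key w (Finset.mem_filter.1 hw).2]
  congr 2
  simp [det₂]; ring

/-- Scaling `v` by units turns the norm of `detSum f` into an average of sums over the level sets
`det₂ v w = c` with `c` a unit; allowing every level only increases it. By Parseval the enlarged sum
is a sum of `‖fourier f (t • v)‖ ^ 2`, where only units `t` survive, so the number of units cancels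
on both sides. -/
theorem sum_detSum_sq_le {f : ZMod n × ZMod n → ℝ}
    (hf : ∀ d (h : d ∣ n), d ≠ n → ∀ [NeZero d], push h f = 0) :
    ∑ v, detSum f v ^ 2 ≤ n * ∑ v, f v ^ 2 := by
  let e : (ZMod n)ˣ → (ZMod n × ZMod n) ≃ (ZMod n × ZMod n) := fun c =>
    ⟨fun v => (c : ZMod n) • v, fun v => ((c⁻¹ : (ZMod n)ˣ) : ZMod n) • v,
      fun v => by simp [smul_smul], fun v => by simp [smul_smul]⟩
  have hsmul : ∀ (c : (ZMod n)ˣ) v, detSum f ((c : ZMod n) • v) =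
      ∑ w with det₂ v w = ((c⁻¹ : (ZMod n)ˣ) : ZMod n), f w := by
    intro c v
    refine Finset.sum_congr (Finset.filter_congr fun w _ => ?_) fun _ _ => rfl
    have : det₂ ((c : ZMod n) • v) w = c * det₂ v w := by simp [det₂]; ring
    rw [this, ← Units.mul_right_inj c (b := det₂ v w), Units.mul_inv]
  have hunits : ∀ (g : ZMod n → ℝ), ∑ c : (ZMod n)ˣ, g c = ∑ t with IsUnit t, g t := by
    intro g
    refine Finset.sum_bij (fun c _ => (c : ZMod n)) (by simp) (fun _ _ _ _ h => Units.ext h) ?_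
      fun _ _ => rfl
    rintro t ht
    obtain ⟨c, rfl⟩ := (Finset.mem_filter.1 ht).2
    exact ⟨c, Finset.mem_univ _, rfl⟩
  have hn : (0 : ℝ) < n := Nat.cast_pos.2 (Nat.pos_of_ne_zero (NeZero.ne n))
  have hφ : (0 : ℝ) < Fintype.card (ZMod n)ˣ := Nat.cast_pos.2 Fintype.card_pos
  have h1 : (Fintype.card (ZMod n)ˣ : ℝ) * ∑ v, detSum f v ^ 2 ≤
      ∑ v, ∑ s, (∑ w with det₂ v w = s, f w) ^ 2 := by
    calc _ = ∑ c : (ZMod n)ˣ, ∑ v, detSum f ((c : ZMod n) • v) ^ 2 := by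
          have : ∀ c : (ZMod n)ˣ, ∑ v, detSum f ((c : ZMod n) • v) ^ 2 = ∑ v, detSum f v ^ 2 :=
            fun c => Equiv.sum_comp (e c) fun v => detSum f v ^ 2
          simp [this]
      _ = ∑ v, ∑ c : (ZMod n)ˣ, (∑ w with det₂ v w = (c : ZMod n), f w) ^ 2 := by
          rw [Finset.sum_comm]
          refine Finset.sum_congr rfl fun v _ => ?_
          simp only [hsmul]
          exact Equiv.sum_comp (Equiv.inv (ZMod n)ˣ) fun c : (ZMod n)ˣ =>
            (∑ w with det₂ v w = (c : ZMod n), f w) ^ 2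
      _ ≤ _ := by
          refine Finset.sum_le_sum fun v _ => ?_
          rw [hunits fun s => (∑ w with det₂ v w = s, f w) ^ 2]
          exact Finset.sum_le_sum_of_subset_of_nonneg (Finset.filter_subset _ _)
            fun _ _ _ => sq_nonneg _
  have h2 : (n : ℝ) * ∑ v, ∑ s, (∑ w with det₂ v w = s, f w) ^ 2 =
      Fintype.card (ZMod n)ˣ * ((n : ℝ) ^ 2 * ∑ v, f v ^ 2) := by
    rw [Finset.mul_sum, ← sum_norm_sq_fourier]
    simp only [← sum_norm_sq_fourier_smul]
    rw [Finset.sum_comm]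
    calc _ = ∑ t with IsUnit t, ∑ v, ‖fourier f (t • v)‖ ^ 2 := by
          rw [Finset.sum_filter]
          refine Finset.sum_congr rfl fun t _ => ?_
          split_ifs with ht
          · rfl
          · simp [fourier_smul_eq_zero hf ht]
      _ = ∑ c : (ZMod n)ˣ, ∑ v, ‖fourier f ((c : ZMod n) • v)‖ ^ 2 :=
          (hunits fun t => ∑ v, ‖fourier f (t • v)‖ ^ 2).symm
      _ = _ := by
          have : ∀ c : (ZMod n)ˣ,
              ∑ v, ‖fourier f ((c : ZMod n) • v)‖ ^ 2 = ∑ v, ‖fourier f v‖ ^ 2 :=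
            fun c => Equiv.sum_comp (e c) fun v => ‖fourier f v‖ ^ 2
          simp [this]
  have h3 := mul_le_mul_of_nonneg_left h1 hn.le
  rw [h2] at h3
  refine le_of_mul_le_mul_left ?_ (mul_pos hn hφ)
  calc _ = _ := by ring
    _ ≤ _ := h3
    _ = _ := by ring

end Fourier

/-! ### Translation between graph eigenvectors and functions on the plane -/

section Spectrum

theorem detSum_neg {d : ℕ} [NeZero d] {f : ZMod d × ZMod d → ℝ} (hf : ∀ v, f (-v) = f v)
    (v : ZMod d × ZMod d) : detSum f (-v) = detSum f v := by
  rw [detSum, detSum, Finset.sum_filter, Finset.sum_filter]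
  refine Fintype.sum_equiv (Equiv.neg _) _ _ fun w => ?_
  have : det₂ (-v) w = det₂ v (-w) := by simp [det₂]
  simp [hf, this]

variable {n d : ℕ} [NeZero n]

open Classical in
theorem mulVec_adjMatrix_vert (hn : 2 ≤ n) (F : (fareyMap n).Vertex → ℝ)
    (g : SpecialLinearGroup (Fin 2) ℤ) :
    ((fareyMap n).underlyingGraph.adjMatrix ℝ).mulVec F (vert n g) =
      ∑ t : ZMod n, F (vert n (nb n g t)) := by
  rw [SimpleGraph.adjMatrix_mulVec_apply, sum_neighborFinset hn]

open Classical in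
/-- Eigenvectors of the graph give even functions on the plane. -/
theorem exists_detSum_eq_of_hasEigenvalue (hn : 2 ≤ n) {μ : ℝ}
    (hμ : Module.End.HasEigenvalue
      (Matrix.toLin' ((fareyMap n).underlyingGraph.adjMatrix ℝ)) μ) :
    ∃ f : ZMod n × ZMod n → ℝ, f ≠ 0 ∧ (∀ v, f (-v) = f v) ∧
      (∀ v, (∀ w, det₂ v w ≠ 1) → f v = 0) ∧ detSum f = μ • f := by
  obtain ⟨F, hF⟩ := hμ.exists_hasEigenvector
  have hAF := hF.apply_eq_smul
  rw [Matrix.toLin'_apply] at hAF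
  let f : ZMod n × ZMod n → ℝ := fun v =>
    if h : ∃ g, col n g = v then F (vert n h.choose) else 0
  have hf : ∀ g, f (col n g) = F (vert n g) := by
    intro g
    have h : ∃ g', col n g' = col n g := ⟨g, rfl⟩
    simp only [f, dif_pos h]
    exact congrArg F ((vert_eq_iff _ _).2 (.inl h.choose_spec.symm))
  have hf0 : ∀ v, (¬∃ g, col n g = v) → f v = 0 := fun v h => dif_neg h
  refine ⟨f, ?_, ?_, ?_, ?_⟩
  · intro h0
    refine hF.2 (funext fun u => ?_)
    obtain ⟨g, rfl⟩ := vert_surjective u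
    rw [← hf, h0]; rfl
  · intro v
    by_cases h : ∃ g, col n g = v
    · obtain ⟨g, rfl⟩ := h
      rw [← col_neg, hf, hf]
      exact congrArg F ((vert_eq_iff _ _).2 (.inr (by rw [col_neg, neg_neg])))
    · rw [hf0 v h, hf0]
      rintro ⟨g, hg⟩
      exact h ⟨-g, by rw [col_neg, hg, neg_neg]⟩
  · intro v hv
    refine hf0 v ?_
    rintro ⟨g, rfl⟩
    exact hv _ (det₂_col n g)
  · ext v
    rw [Pi.smul_apply, smul_eq_mul]
    by_cases h : ∃ g, col n g = v
    · obtain ⟨g, rfl⟩ := h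
      rw [detSum_eq_sum_add_smul _ (det₂_col n g), hf]
      simp only [← col_nb, hf]
      rw [← mulVec_adjMatrix_vert hn, hAF]; rfl
    · rw [hf0 v h, mul_zero]
      -- If some column `w` had `det₂ v w = 1`, then `det₂ w (-v) = 1`, so `-v` and hence `v` would
      -- be a column as well.
      refine Finset.sum_eq_zero fun w hw => hf0 w ?_
      rintro ⟨g, rfl⟩
      have h1 := (Finset.mem_filter.1 hw).2
      rw [← det₂_neg_swap] at h1
      obtain ⟨t, ht⟩ := eq_add_smul_of_det₂ (det₂_col n g) h1
      exact h ⟨-nb n g t, by rw [col_neg, col_nb, ← ht, neg_neg]⟩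

/-- The function on vertices given by an even function on the plane modulo a divisor of `n`. -/
noncomputable def pull (h : d ∣ n) (f : ZMod d × ZMod d → ℝ) (u : (fareyMap n).Vertex) : ℝ :=
  f (redVec h (col n (vert_surjective u).choose))

theorem pull_vert (h : d ∣ n) {f : ZMod d × ZMod d → ℝ} (hf : ∀ v, f (-v) = f v)
    (g : SpecialLinearGroup (Fin 2) ℤ) : pull h f (vert n g) = f (redVec h (col n g)) := by
  rcases (vert_eq_iff _ _).1 (vert_surjective (vert n g)).choose_spec with h1 | h1
  · rw [pull, h1]
  · rw [pull, h1, map_neg, hf]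

theorem pull_ne_zero (h : d ∣ n) {f : ZMod d × ZMod d → ℝ} (hf : ∀ v, f (-v) = f v)
    (h1 : f (1, 0) ≠ 0) : pull h f ≠ 0 := by
  intro h0
  have h2 := congrFun h0 (vert n 1)
  rw [pull_vert h hf] at h2
  have h3 : redVec h (col n 1) = (1, 0) := by
    rw [redVec_apply]; simp [col, -ZMod.castHom_apply]
  rw [h3] at h2
  exact h1 h2

theorem pull_congr (h : d ∣ n) {f f' : ZMod d × ZMod d → ℝ}
    (hff' : ∀ v w, det₂ v w = 1 → f v = f' v) : pull h f = pull h f' := by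
  ext u
  refine hff' _ (redVec h (col' n (vert_surjective u).choose)) ?_
  rw [det₂_redVec, det₂_col, map_one]

variable [NeZero d]

open Classical in
theorem mulVec_pull (hn : 2 ≤ n) (h : d ∣ n) {f : ZMod d × ZMod d → ℝ} (hf : ∀ v, f (-v) = f v) :
    ((fareyMap n).underlyingGraph.adjMatrix ℝ).mulVec (pull h f) =
      (n / d : ℝ) • pull h (detSum f) := by
  ext u
  obtain ⟨g, rfl⟩ := vert_surjective u
  rw [mulVec_adjMatrix_vert hn, Pi.smul_apply, smul_eq_mul, pull_vert h (detSum_neg hf),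
    ← detSum_comp_redVec h f (det₂_col n g), detSum_eq_sum_add_smul _ (det₂_col n g)]
  simp only [pull_vert h hf, col_nb]

open Classical in
theorem hasEigenvalue_of_detSum (hn : 2 ≤ n) (h : d ∣ n) {f : ZMod d × ZMod d → ℝ}
    (hf : ∀ v, f (-v) = f v) (h1 : f (1, 0) ≠ 0) {c : ℝ}
    (hc : ∀ v w, det₂ v w = 1 → detSum f v = c * f v) :
    Module.End.HasEigenvalue (Matrix.toLin' ((fareyMap n).underlyingGraph.adjMatrix ℝ))
      (n / d * c) := by
  refine Module.End.hasEigenvalue_of_hasEigenvector (x := pull h f)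
    ⟨Module.End.mem_eigenspace_iff.2 ?_, pull_ne_zero h hf h1⟩
  rw [Matrix.toLin'_apply, mulVec_pull hn h hf, mul_smul]
  have : pull h (detSum f) = c • pull h f := pull_congr h hc
  rw [this]

/-- Since `(T - c) (T + c) x = 0`, the vector `(T + c) x` is either zero, making `x` an eigenvector
for `-c`, or itself an eigenvector for `c`. -/
theorem hasEigenvalue_or_neg {V : Type*} [AddCommGroup V] [Module ℝ V] {T : Module.End ℝ V}
    {x : V} {c : ℝ} (hx : x ≠ 0) (h : T (T x) = (c * c) • x) :
    T.HasEigenvalue c ∨ T.HasEigenvalue (-c) := by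
  by_cases h0 : T x + c • x = 0
  · right
    refine Module.End.hasEigenvalue_of_hasEigenvector (x := x)
      ⟨Module.End.mem_eigenspace_iff.2 ?_, hx⟩
    rw [neg_smul]; exact eq_neg_of_add_eq_zero_left h0
  · left
    refine Module.End.hasEigenvalue_of_hasEigenvector (x := T x + c • x)
      ⟨Module.End.mem_eigenspace_iff.2 ?_, h0⟩
    rw [map_add, map_smul, h, smul_add, smul_smul, add_comm]

open Classical in
theorem hasEigenvalue_of_detSum_detSum (hn : 2 ≤ n) (h : d ∣ n) {f : ZMod d × ZMod d → ℝ}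
    (hf : ∀ v, f (-v) = f v) (h1 : f (1, 0) ≠ 0) {c : ℝ}
    (hc : ∀ v w, det₂ v w = 1 → detSum (detSum f) v = c * c * f v) :
    Module.End.HasEigenvalue (Matrix.toLin' ((fareyMap n).underlyingGraph.adjMatrix ℝ))
      (n / d * c) ∨
    Module.End.HasEigenvalue (Matrix.toLin' ((fareyMap n).underlyingGraph.adjMatrix ℝ))
      (-(n / d * c)) := by
  refine hasEigenvalue_or_neg (pull_ne_zero h hf h1) ?_
  have h2 : pull h (detSum (detSum f)) = (c * c) • pull h f := pull_congr h hc
  rw [Matrix.toLin'_apply, Matrix.toLin'_apply, mulVec_pull hn h hf, Matrix.mulVec_smul,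
    mulVec_pull hn h (detSum_neg hf), h2, smul_smul, smul_smul]
  congr 1; ring

end Spectrum

/-! ### Explicit eigenvectors modulo a prime -/

section Prime

/-- Modulo `3` the conditions `det₂ v w = ±1` and `w = ±v` partition the nonzero vectors; modulo `2`
the signs coincide and each vector is counted twice. -/
theorem sum_ite_det₂ {p : ℕ} (hp : p = 2 ∨ p = 3) :
    ∀ v w : ZMod p × ZMod p, (∃ u, det₂ v u = 1) → w ≠ 0 →
      (if det₂ v w = 1 then 1 else 0) + (if det₂ v w = -1 then 1 else 0) +
        (if w = v then 1 else 0) + (if w = -v then 1 else 0) = 4 - p := by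
  rcases hp with rfl | rfl <;> decide

/-- Modulo `2` and `3` the even functions with sum zero are eigenvectors for `-1`. -/
theorem detSum_eq_neg {p : ℕ} [NeZero p] (hp : p = 2 ∨ p = 3) {f : ZMod p × ZMod p → ℝ}
    (hf : ∀ v, f (-v) = f v) (h0 : f 0 = 0) (hsum : ∑ v, f v = 0) (v w : ZMod p × ZMod p)
    (hvw : det₂ v w = 1) : detSum f v = -1 * f v := by
  -- Pairing `f` with this constant count gives zero, while evenness makes the left side `2 * detSum
  -- f v + 2 * f v`.
  have h1 : ∑ u, f u * (((if det₂ v u = 1 then 1 else 0) + (if det₂ v u = -1 then 1 else 0) +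
        (if u = v then 1 else 0) + (if u = -v then 1 else 0) : ℕ) : ℝ) = 0 := by
    refine Eq.trans ?_ ((Finset.mul_sum _ _ ((4 - p : ℕ) : ℝ)).symm.trans (by rw [hsum, mul_zero]))
    refine Finset.sum_congr rfl fun u _ => ?_
    by_cases hu : u = 0
    · rw [hu, h0, zero_mul, mul_zero]
    · rw [sum_ite_det₂ hp v u ⟨w, hvw⟩ hu, mul_comm]
  push_cast at h1
  simp only [mul_add, mul_ite, mul_one, mul_zero, Finset.sum_add_distrib, Finset.sum_ite_eq',
    Finset.mem_univ, if_true, hf] at h1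
  have h2 : ∑ u, (if det₂ v u = -1 then f u else 0) = detSum f v := by
    rw [detSum, Finset.sum_filter]
    refine Fintype.sum_equiv (Equiv.neg _) _ _ fun u => ?_
    simp [hf, det₂_neg_right, neg_eq_iff_eq_neg]
  rw [h2, ← Finset.sum_filter] at h1
  change detSum f v + _ + _ + _ = 0 at h1
  linarith

/-- Functions supported on one line, with sum zero on it, are eigenvectors of `detSum` squared. -/
theorem detSum_detSum_line {p : ℕ} [Fact p.Prime] {k : ZMod p → ℝ} (hk : ∀ a, k (-a) = k a)
    (h0 : k 0 = 0) (hsum : ∑ a, k a = 0) (v w : ZMod p × ZMod p) (hvw : det₂ v w = 1) :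
    detSum (detSum fun u => if u.2 = 0 then k u.1 else 0) v =
      p * (if v.2 = 0 then k v.1 else 0) := by
  -- Only the point `(-u.2⁻¹, 0)` of the line has determinant one with `u`. When `u.2 = 0` there is
  -- none, which agrees with `0⁻¹ = 0` and `k 0 = 0`.
  have h1 : ∀ u : ZMod p × ZMod p,
      detSum (fun u => if u.2 = 0 then k u.1 else 0) u = k u.2⁻¹ := by
    intro u
    rw [detSum, Finset.sum_filter, Fintype.sum_prod_type]
    simp only [det₂]
    rw [Finset.sum_eq_single (-u.2⁻¹)]
    · rw [Finset.sum_eq_single 0]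
      · by_cases hu : u.2 = 0
        · simp [hu, h0]
        · simp [hu, hk]
      · intro b _ hb; simp [hb]
      · simp
    · intro a _ ha
      refine Finset.sum_eq_zero fun b _ => ?_
      by_cases hb : b = 0
      · rw [if_neg]
        subst hb
        intro h
        apply ha
        rw [← inv_neg]
        refine eq_inv_of_mul_eq_one_left ?_
        linear_combination h
      · simp [hb]
    · simp
  rw [detSum_eq_sum_add_smul _ hvw]
  simp only [h1, Prod.snd_add, Prod.smul_snd, smul_eq_mul]
  rw [det₂] at hvw
  by_cases hv : v.2 = 0
  · simp only [hv, mul_zero, add_zero, Finset.sum_const, Finset.card_univ, ZMod.card, if_true,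
      nsmul_eq_mul]
    rw [hv, zero_mul, sub_zero] at hvw
    rw [eq_inv_of_mul_eq_one_left hvw]
  · rw [if_neg hv, mul_zero, ← hsum]
    refine Function.Bijective.sum_comp (e := fun t : ZMod p => (w.2 + t * v.2)⁻¹) ?_ k
    refine (Finite.injective_iff_bijective).1 fun s t hst => ?_
    exact mul_right_cancel₀ hv (add_left_cancel (inv_injective hst))

theorem sum_ite_line {p : ℕ} [NeZero p] (hp : p = 2 ∨ p = 3) :
    ∑ v : ZMod p × ZMod p, (if v = 0 then 0 else if v.2 = 0 then (p : ℤ) else -1) = 0 := by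
  have h2 : ∑ v : ZMod 2 × ZMod 2, (if v = 0 then 0 else if v.2 = 0 then (2 : ℤ) else -1) = 0 := by
    decide
  have h3 : ∑ v : ZMod 3 × ZMod 3, (if v = 0 then 0 else if v.2 = 0 then (3 : ℤ) else -1) = 0 := by
    decide
  rcases hp with rfl | rfl
  · exact h2
  · exact h3

open Classical in
theorem hasEigenvalue_neg_div {n p : ℕ} [NeZero n] [NeZero p] (hn : 2 ≤ n) (hp : p = 2 ∨ p = 3)
    (h : p ∣ n) : Module.End.HasEigenvalue
      (Matrix.toLin' ((fareyMap n).underlyingGraph.adjMatrix ℝ)) (n / p * -1) := by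
  -- The `p - 1` nonzero points of one line get weight `p`, balancing the `p ^ 2 - p` points off it.
  let f : ZMod p × ZMod p → ℝ := fun v =>
    (((if v = 0 then 0 else if v.2 = 0 then p else -1) : ℤ) : ℝ)
  have hf : ∀ v, f (-v) = f v := fun v => by simp [f]
  have hsum : ∑ v, f v = 0 := by
    rw [← Int.cast_sum, Int.cast_eq_zero]
    exact sum_ite_line hp
  have h1 : f (1, 0) ≠ 0 := by
    have : Fact (1 < p) := ⟨by omega⟩
    simp [f, NeZero.ne]
  exact hasEigenvalue_of_detSum hn h hf h1
    (detSum_eq_neg hp hf (by simp [f]) hsum)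

open Classical in
theorem hasEigenvalue_sqrt {n p : ℕ} [NeZero n] [Fact p.Prime] (hn : 2 ≤ n) (hp : 5 ≤ p)
    (h : p ∣ n) :
    Module.End.HasEigenvalue (Matrix.toLin' ((fareyMap n).underlyingGraph.adjMatrix ℝ))
      (n / p * √p) ∨
    Module.End.HasEigenvalue (Matrix.toLin' ((fareyMap n).underlyingGraph.adjMatrix ℝ))
      (-(n / p * √p)) := by
  -- An even function of sum zero that vanishes at `0` and not at `1`; `p ≥ 5` keeps the classes
  -- `±1` and `±2` apart.
  let k : ZMod p → ℝ := fun a => (if a = 1 then 1 else 0) + (if a = -1 then 1 else 0) -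
    (if a = 2 then 1 else 0) - (if a = -2 then 1 else 0)
  have hk : ∀ a, k (-a) = k a := fun a => by
    simp only [k, neg_eq_iff_eq_neg, neg_neg]; ring
  have hne : ∀ m : ℕ, 0 < m → m < 5 → (m : ZMod p) ≠ 0 := fun m h1 h2 h3 => by
    rw [ZMod.natCast_eq_zero_iff] at h3
    have := Nat.le_of_dvd h1 h3
    omega
  have h1 := hne 1 (by norm_num) (by norm_num)
  have h2 := hne 2 (by norm_num) (by norm_num)
  have h3 := hne 3 (by norm_num) (by norm_num)
  push_cast at h1 h2 h3
  have h0 : k 0 = 0 := by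
    simp [k, h1, h2, h1.symm, h2.symm, zero_eq_neg]
  have hsum : ∑ a, k a = 0 := by simp [k, Finset.sum_add_distrib, Finset.sum_sub_distrib]
  refine hasEigenvalue_of_detSum_detSum hn h (f := fun u => if u.2 = 0 then k u.1 else 0)
    (fun v => by simp [hk]) ?_ ?_
  · have e1 : (1 : ZMod p) ≠ -1 := fun e => h2 (by linear_combination e)
    have e2 : (1 : ZMod p) ≠ 2 := fun e => h1 (by linear_combination -e)
    have e3 : (1 : ZMod p) ≠ -2 := fun e => h3 (by linear_combination e)
    simp only [k, if_true, if_neg e1, if_neg e2, if_neg e3]; norm_num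
  · rw [Real.mul_self_sqrt (Nat.cast_nonneg p)]
    exact detSum_detSum_line hk h0 hsum

end Prime

/-! ### The upper bound for eigenvalues -/

section Bound

/-- Every eigenvalue of modulus other than `n` comes from a level `d ≥ 2` dividing `n`. -/
theorem exists_dvd_mul_le {n : ℕ} [NeZero n] {μ : ℝ} (hμ : |μ| ≠ n)
    {f : ZMod n × ZMod n → ℝ} (hf0 : f ≠ 0) (hf : ∀ v, f (-v) = f v)
    (hsupp : ∀ v, (∀ w, det₂ v w ≠ 1) → f v = 0) (hfμ : detSum f = μ • f) :
    ∃ d, d ∣ n ∧ 2 ≤ d ∧ μ ^ 2 * d ≤ n ^ 2 ∧ (d = 2 ∨ d = 3 → μ ^ 2 * d ^ 2 = n ^ 2) := by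
  classical
  -- The least level at which a fibre sum of `f` survives; minimality kills every fibre sum of `F`
  -- at a proper divisor.
  have hex : ∃ d, ∃ _ : NeZero d, ∃ h : d ∣ n, push h f ≠ 0 :=
    ⟨n, inferInstance, dvd_rfl, by rwa [push_self]⟩
  obtain ⟨hd0, hdn, hF0⟩ := Nat.find_spec hex
  have hmin : ∀ m, m < Nat.find hex → ∀ (_ : NeZero m) (h : m ∣ n), push h f = 0 := by
    intro m hm h0 h
    by_contra hne
    exact Nat.find_min hex hm ⟨h0, h, hne⟩
  generalize Nat.find hex = d at *
  set F := push hdn f with hFdef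
  have hnew : ∀ e (h : e ∣ d), e ≠ d → ∀ [NeZero e], push h F = 0 := by
    intro e h hne he
    rw [hFdef, push_push]
    exact hmin e (lt_of_le_of_ne (Nat.le_of_dvd (Nat.pos_of_ne_zero hd0.ne) h) hne) he _
  have hFe : ∀ v, F (-v) = F v := push_neg_of_even hdn hf
  have hFs := push_eq_zero hdn hsupp
  have hFμ : ∀ x, (n / d : ℝ) * detSum F x = μ * F x := by
    intro x
    rw [hFdef, detSum_push hdn hsupp, hfμ, push, push, Finset.mul_sum]
    rfl
  have hn : (0 : ℝ) < n := Nat.cast_pos.2 (Nat.pos_of_ne_zero (NeZero.ne n))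
  have hd : (0 : ℝ) < d := Nat.cast_pos.2 (Nat.pos_of_ne_zero (NeZero.ne d))
  obtain ⟨x, hx⟩ := Function.ne_iff.1 hF0
  rw [Pi.zero_apply] at hx
  have hd1 : d ≠ 1 := by
    rintro rfl
    have h1 := hFμ x
    have h2 : detSum F x = F x := by
      rw [detSum, Finset.filter_true_of_mem fun _ _ => Subsingleton.elim _ _]
      rw [Fintype.sum_subsingleton _ x]
    rw [h2, Nat.cast_one, div_one] at h1
    exact hμ (by rw [← mul_right_cancel₀ hx h1, Nat.abs_cast])
  refine ⟨d, hdn, ?_, ?_, ?_⟩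
  · have := hd0.ne; omega
  · have h1 := sum_detSum_sq_le hnew
    have h2 : (n : ℝ) ^ 2 * ∑ v, detSum F v ^ 2 = d ^ 2 * (μ ^ 2 * ∑ v, F v ^ 2) := by
      rw [Finset.mul_sum, Finset.mul_sum, Finset.mul_sum]
      refine Finset.sum_congr rfl fun v _ => ?_
      have h3 := hFμ v
      rw [div_mul_eq_mul_div, div_eq_iff hd.ne'] at h3
      rw [← mul_pow, h3]; ring
    have h4 : 0 < ∑ v, F v ^ 2 :=
      Finset.sum_pos' (fun _ _ => sq_nonneg _) ⟨x, Finset.mem_univ _, by positivity⟩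
    have h5 := mul_le_mul_of_nonneg_left h1 (sq_nonneg (n : ℝ))
    rw [h2] at h5
    refine le_of_mul_le_mul_right ?_ (mul_pos hd h4)
    calc _ = _ := by ring
      _ ≤ _ := h5
      _ = _ := by ring
  · intro hp
    have hsum : ∑ v, F v = 0 := by
      have h1 := congrFun (hnew 1 (one_dvd d) hd1.symm) 0
      rwa [push, Finset.filter_true_of_mem fun _ _ => Subsingleton.elim _ _] at h1
    obtain ⟨w, hw⟩ : ∃ w, det₂ x w = 1 := by
      by_contra! h
      exact hx (hFs x h)
    have h01 : (0 : ZMod d) ≠ 1 := by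
      rcases hp with rfl | rfl <;> decide
    have h1 := hFμ x
    rw [detSum_eq_neg hp hFe (hFs 0 fun w => by simpa [det₂] using h01) hsum x w hw] at h1
    have h2 : (n / d : ℝ) * -1 = μ := mul_right_cancel₀ hx (by rw [← h1]; ring)
    rw [← h2]
    field_simp

end Bound

/-! ### Comparison with the Ramanujan bound -/

theorem mem_of_even_of_lt {n : ℕ} (h : 2 ∣ n) (hn : 2 ≤ n) (h16 : n < 16) :
    n.Prime ∨ n ∈ ({4, 6, 8, 9, 10, 12, 14, 15, 21, 27, 33} : Set ℕ) := by
  interval_cases n <;> first | omega | norm_num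

theorem mem_of_three_dvd_of_lt {n : ℕ} (h : 3 ∣ n) (h2 : ¬2 ∣ n) (hn : 2 ≤ n) (h36 : n < 36) :
    n.Prime ∨ n ∈ ({4, 6, 8, 9, 10, 12, 14, 15, 21, 27, 33} : Set ℕ) := by
  interval_cases n <;> first | omega | norm_num

open Classical in
theorem isRamanujan_fareyMap_iff {n : ℕ} [NeZero n] (hn : 2 ≤ n) :
    IsRamanujan (fareyMap n).underlyingGraph ↔
      n.Prime ∨ n ∈ ({4, 6, 8, 9, 10, 12, 14, 15, 21, 27, 33} : Set ℕ) := by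
  have hn' : (2 : ℝ) ≤ n := by exact_mod_cast hn
  constructor
  · rintro ⟨-, d, hreg, hd⟩
    obtain rfl : d = n := (hreg (vert n 1)).symm.trans (isRegularOfDegree_fareyMap hn _)
    -- No eigenvalue has modulus `d * c` between `2 * √(d - 1)` and `d`; it is used with `c = 1 / p`
    -- and `c = 1 / √p`, the latter written `√p / p`.
    have key : ∀ c : ℝ, 0 ≤ c → c < 1 → 4 * ((d : ℝ) - 1) ≤ (d * c) ^ 2 → ∀ μ : ℝ, |μ| = d * c →
        ¬ Module.End.HasEigenvalue
          (Matrix.toLin' ((fareyMap d).underlyingGraph.adjMatrix ℝ)) μ := by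
      intro c hc0 hc1 hc μ hμ he
      have h1 := hd μ he (by rw [hμ]; nlinarith)
      rw [hμ] at h1
      have h2 : (d * c) ^ 2 < (2 * √((d : ℝ) - 1)) ^ 2 :=
        pow_lt_pow_left₀ h1 (by positivity) two_ne_zero
      rw [mul_pow 2, Real.sq_sqrt (by linarith)] at h2
      linarith
    have small : ∀ p : ℕ, p = 2 ∨ p = 3 → p ∣ d → d ^ 2 < 4 * (d - 1) * p ^ 2 := by
      intro p hp h
      have hp0 : (2 : ℝ) ≤ p := by rcases hp with rfl | rfl <;> norm_num
      have : NeZero p := ⟨by omega⟩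
      by_contra! hlt
      refine key (1 / p) (by positivity) ?_ ?_ _ ?_ (hasEigenvalue_neg_div hn hp h)
      · rw [div_lt_one (by linarith)]; linarith
      · rw [mul_one_div, div_pow, le_div_iff₀ (by positivity)]
        have : ((4 * (d - 1) * p ^ 2 : ℕ) : ℝ) ≤ ((d ^ 2 : ℕ) : ℝ) := by exact_mod_cast hlt
        push_cast [Nat.cast_sub (show 1 ≤ d by omega)] at this
        linarith
      · rw [abs_mul, abs_neg, abs_one, mul_one, mul_one_div, abs_of_nonneg (by positivity)]
    by_cases h2 : 2 ∣ d
    · have h := small 2 (.inl rfl) h2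
      -- The inequality `d ^ 2 < 16 * (d - 1)` fails from `16` on; likewise `d ^ 2 < 36 * (d - 1)`
      -- fails from `36` on in the case `3 ∣ d`.
      have : d < 16 := by
        by_contra! hlt
        obtain ⟨m, rfl⟩ := Nat.exists_eq_add_of_le hlt
        have : 16 + m - 1 = 15 + m := by omega
        rw [this] at h
        nlinarith
      exact mem_of_even_of_lt h2 hn this
    by_cases h3 : 3 ∣ d
    · have h := small 3 (.inr rfl) h3
      have : d < 36 := by
        by_contra! hlt
        obtain ⟨m, rfl⟩ := Nat.exists_eq_add_of_le hlt
        have : 36 + m - 1 = 35 + m := by omega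
        rw [this] at h
        nlinarith
      exact mem_of_three_dvd_of_lt h3 h2 hn this
    left
    by_contra hprime
    have hp := Nat.minFac_prime (show d ≠ 1 by omega)
    have hpd := Nat.minFac_dvd d
    have hle := Nat.minFac_sq_le_self (by omega) hprime
    generalize d.minFac = p at *
    have : Fact p.Prime := ⟨hp⟩
    have hp5 : 5 ≤ p := by
      by_contra! hlt
      interval_cases p <;> first | omega | exact absurd hp (by norm_num)
    have hp0 : (5 : ℝ) ≤ p := by exact_mod_cast hp5
    have hle' : (p : ℝ) ^ 2 ≤ d := by exact_mod_cast hle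
    have hs : (√p) ^ 2 = (p : ℝ) := Real.sq_sqrt (by linarith)
    have hc : d * (√p / p) = d / p * √p := by ring
    have key' := key (√p / p) (by positivity)
      (by rw [div_lt_one (by linarith), Real.sqrt_lt' (by linarith)]; nlinarith)
      -- From `p ^ 2 ≤ d` one gets `d ^ 2 / p ≥ p * d ≥ 5 * d`, which exceeds `4 * (d - 1)`.
      (by
        rw [mul_pow, div_pow, hs, sq (p : ℝ), div_mul_cancel_left₀ (by linarith), ← div_eq_mul_inv,
          le_div_iff₀ (by linarith)]
        nlinarith)
    rcases hasEigenvalue_sqrt hn hp5 hpd with he | he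
    · exact key' _ (by rw [hc, abs_of_nonneg (by positivity)]) he
    · exact key' _ (by rw [hc, abs_neg, abs_of_nonneg (by positivity)]) he
  · intro hlist
    refine ⟨connected_fareyMap hn, n, isRegularOfDegree_fareyMap hn, fun μ hμ hne => ?_⟩
    obtain ⟨f, hf0, hf, hsupp, hfμ⟩ := exists_detSum_eq_of_hasEigenvalue hn hμ
    obtain ⟨d, hdn, hd2, hle, h23⟩ := exists_dvd_mul_le hne hf0 hf hsupp hfμ
    suffices h : μ ^ 2 < 4 * (n - 1) by
      refine abs_lt_of_sq_lt_sq ?_ (by positivity)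
      rw [mul_pow, Real.sq_sqrt (by linarith)]
      linarith
    rcases hlist with hp | hlist
    · obtain rfl : d = n := ((Nat.dvd_prime hp).1 hdn).resolve_left (by omega)
      have : μ ^ 2 ≤ d := by nlinarith
      by_contra! h4
      linarith
    · have hdle : d ≤ n := Nat.le_of_dvd (by omega) hdn
      simp only [Set.mem_insert_iff, Set.mem_singleton_iff] at hlist
      -- The general bound `n ^ 2 / d` does not suffice at `d = 2, 3`: for `n = 14`, `d = 2` it
      -- gives `98 > 52`, whereas the exact value is `μ ^ 2 = 49`.
      rcases hlist with rfl | rfl | rfl | rfl | rfl | rfl | rfl | rfl | rfl | rfl | rfl <;>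
        interval_cases d <;> first
          | (exfalso; revert hdn; decide)
          | (norm_num at hle h23 ⊢; linarith)

end Farey

theorem mainTheorem5 (n : ℕ) [NeZero n] (hn : 2 ≤ n) :
    IsRamanujan (Farey.fareyMap n).underlyingGraph ↔
      n.Prime ∨ n ∈ ({4, 6, 8, 9, 10, 12, 14, 15, 21, 27, 33} : Set ℕ) :=
  Farey.isRamanujan_fareyMap_iff hn
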